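/- Let $X$ be a real Banach space with property $(*)$ with constant $C_0$: for every Lipschitz function $h:X\to\mathbb R$ and every $\eta>0$ there is a Lipschitz $C^1$ function $K:X\to\mathbb R$ with $|h(x)-K(x)|<\eta$ for all $x\in X$ and $\operatorname{Lip}(K)\le C_0\operatorname{Lip}(h)$, where $\operatorname{Lip}$ denotes the least Lipschitz constant. Put $C_1:=33\,C_0$. Let $Y\subset X$ be a closed subset, $Z:=\overline{\operatorname{span}}\{y-y':y,y'\in Y\}$, and let $f:Y\to\mathbb R$ satisfy condition (E) for a continuous mapping $D:Y\to Z^*$: for all $y\in Y$ and $\eta>0$ there is $r>0$ such that $$|f(z)-f(w)-D(y)(z-w)|\le\eta\,\|z-w\|\qquad\text{for all } z,w\in Y\cap B(y,r).$$ Let $F:X\to\mathbb R$ be a continuous extension of $f$. Then for every $\varepsilon>0$ there is a $C^1$ function $G:X\to\mathbb R$ such that (i) $|F(x)-G(x)|<\varepsilon$ for all $x\in X$; (ii) $\|D(y)-G'(y)|_Z\|_{Z^*}<\varepsilon$ for all $y\in Y$, and $f-G|_Y$ is Lipschitz on $Y$ with $\operatorname{Lip}(f-G|_Y)<\varepsilon$;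 (iii) furthermore, if $f$ is Lipschitz on $Y$, $F$ is Lipschitz on $X$ and $M:=\sup\{\|D(y)\|_{Z^*}:y\in Y\}<\infty$ (with $M:=0$ if $Y=\emptyset$), then $G$ can be chosen (still satisfying (i) and (ii)) to be Lipschitz on $X$ with $\operatorname{Lip}(G)\le\frac{\varepsilon}{4}+(1+C_1)M+C_1\operatorname{Lip}(F)$. -/

import Mathlib

open scoped NNReal

/-- `g` is a Lipschitz function. -/
def IsLip {α : Type*} [PseudoMetricSpace α] (g : α → ℝ) : Prop :=
  ∃ K : ℝ≥0, LipschitzWith K g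

/-- `Lip(g)`: the least Lipschitz constant of a Lipschitz function `g`
(only meaningful together with `IsLip g`). -/
noncomputable def lipConst {α : Type*} [PseudoMetricSpace α] (g : α → ℝ) : ℝ :=
  ((sInf {K : ℝ≥0 | LipschitzWith K g} : ℝ≥0) : ℝ)

/-- The space `X` has property (*) with the constant `C₀`: every real-valued Lipschitz function
on `X` can be uniformly approximated, to any accuracy, by `C¹` Lipschitz functions `K` with
`Lip(K) ≤ C₀ Lip(f)`. -/
def PropertyStar (X : Type*) [NormedAddCommGroup X] [NormedSpace ℝ X] (C₀ : ℝ) : Prop :=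
  ∀ f : X → ℝ, IsLip f → ∀ ε : ℝ, 0 < ε →
    ∃ K : X → ℝ, ContDiff ℝ 1 K ∧ IsLip K ∧ (∀ x, |f x - K x| < ε) ∧
      lipConst K ≤ C₀ * lipConst f

/-- `Z`, the closed linear span of the differences `y - y'` with `y, y' ∈ Y`. -/
def diffSpan {X : Type*} [NormedAddCommGroup X] [NormedSpace ℝ X] (Y : Set X) : Submodule ℝ X :=
  (Submodule.span ℝ {v : X | ∃ y ∈ Y, ∃ y' ∈ Y, v = y - y'}).topologicalClosure

theorem sub_mem_diffSpan {X : Type*} [NormedAddCommGroup X] [NormedSpace ℝ X] {Y : Set X}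
    (z w : Y) : (z : X) - (w : X) ∈ diffSpan Y :=
  Submodule.le_topologicalClosure _
    (Submodule.subset_span ⟨z, z.2, w, w.2, rfl⟩)

/-- The mean value condition (E) for `f : Y → ℝ` and `D : Y → Z*`. -/
def ConditionE {X : Type*} [NormedAddCommGroup X] [NormedSpace ℝ X] {Y : Set X}
    (f : Y → ℝ) (D : Y → (diffSpan Y →L[ℝ] ℝ)) : Prop :=
  ∀ y : Y, ∀ ε : ℝ, 0 < ε → ∃ r : ℝ, 0 < r ∧
    ∀ z w : Y, (z : X) ∈ Metric.ball (y : X) r → (w : X) ∈ Metric.ball (y : X) r →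
      |f z - f w - D y ⟨(z : X) - (w : X), sub_mem_diffSpan z w⟩| ≤ ε * ‖(z : X) - (w : X)‖

/-! On a small ball about `y ∈ Y`, extend `D y` to a functional `T` by Hahn–Banach. Condition (E)
makes `T - F` Lipschitz with a tiny constant on the part of `Y` in the ball. Approximating `T - F`
by a `C¹` function that is still almost constant there, and subtracting the result from `T`, gives a
local approximant with the right derivative along `Z` (`exists_local_approx`). Off `Y` any `C¹`
approximation of `F` will do.

The local pieces are glued by a partition of unity following M. E. Rudin's proof of paracompactness
(`exists_smoothPartition`). It consists of countably many functions `ψ n`, each serving a whole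
family of separated patches, with a derivative bound `L n` known before the pieces are chosen. The
pieces used with `ψ n` approximate `F` to within `e n`, where `∑ L n * e n ≤ ε / 4`, so
differentiating the weights costs at most `ε / 4`.

The Lipschitz bound on `f - G` cannot be read off from derivatives, since (E) speaks only of points
of `Y`; `abs_sub_glue_sub_le` compares the two values directly, using the separation of patches. -/

open Filter Topology

/-! ### Least Lipschitz constants. -/

section LipConst

variable {α : Type*} [PseudoMetricSpace α]

theorem lipConst_nonneg (g : α → ℝ) : 0 ≤ lipConst g := NNReal.coe_nonneg _

theorem LipschitzWith.lipConst_le {g : α → ℝ} {K : ℝ≥0} (h : LipschitzWith K g) :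
    lipConst g ≤ K :=
  NNReal.coe_le_coe.2 (csInf_le (OrderBot.bddBelow _) h)

theorem IsLip.dist_le {g : α → ℝ} (h : IsLip g) (x y : α) :
    |g x - g y| ≤ lipConst g * dist x y := by
  have key : ∀ K ∈ {K : ℝ≥0 | LipschitzWith K g}, |g x - g y| ≤ K * dist x y := by
    intro K hK
    simpa [Real.dist_eq] using hK.dist_le_mul x y
  -- At distance zero one cannot divide, but any admissible constant already gives the claim.
  rcases (dist_nonneg (x := x) (y := y)).eq_or_lt with h0 | h0
  · obtain ⟨K, hK⟩ := h
    simpa [← h0] using key K hK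
  · rw [← div_le_iff₀ h0]
    have : Real.toNNReal (|g x - g y| / dist x y) ≤ sInf {K : ℝ≥0 | LipschitzWith K g} := by
      refine le_csInf h fun K hK => ?_
      rw [Real.toNNReal_le_iff_le_coe, div_le_iff₀ h0]
      exact key K hK
    exact Real.toNNReal_le_iff_le_coe.1 this

theorem lipschitzWith_of_abs_sub_le {g : α → ℝ} {c : ℝ} (hc : 0 ≤ c)
    (h : ∀ x y, |g x - g y| ≤ c * dist x y) : LipschitzWith c.toNNReal g :=
  LipschitzWith.of_dist_le_mul fun x y => by
    simpa [Real.dist_eq, Real.coe_toNNReal c hc] using h x y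

theorem isLip_and_lipConst_le {g : α → ℝ} {c : ℝ} (hc : 0 ≤ c)
    (h : ∀ x y, |g x - g y| ≤ c * dist x y) : IsLip g ∧ lipConst g ≤ c := by
  have := lipschitzWith_of_abs_sub_le hc h
  exact ⟨⟨_, this⟩, by simpa [Real.coe_toNNReal c hc] using this.lipConst_le⟩

end LipConst

/-! ### Property (*), smooth bumps and smooth partitions of unity. -/

section Star

variable {X : Type*} [NormedAddCommGroup X] [NormedSpace ℝ X]

theorem PropertyStar.mono {C C' : ℝ} (h : PropertyStar X C) (hC : C ≤ C') :
    PropertyStar X C' := by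
  intro f hf ε hε
  obtain ⟨K, h1, h2, h3, h4⟩ := h f hf ε hε
  exact ⟨K, h1, h2, h3, h4.trans (mul_le_mul_of_nonneg_right hC (lipConst_nonneg f))⟩

/-- A negative constant forces the norm to have Lipschitz constant zero. This disposes of the
degenerate case in which `C₀` has no sign. -/
theorem PropertyStar.subsingleton {C : ℝ} (h : PropertyStar X C) (hC : C < 0) :
    Subsingleton X := by
  have hl : IsLip (fun x : X => ‖x‖) := ⟨1, lipschitzWith_one_norm⟩
  obtain ⟨K, -, -, -, h4⟩ := h _ hl 1 one_pos
  have h5 := lipConst_nonneg K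
  have h6 := lipConst_nonneg (fun x : X => ‖x‖)
  have h7 : lipConst (fun x : X => ‖x‖) = 0 := by nlinarith
  refine subsingleton_of_forall_eq 0 fun x => ?_
  have := hl.dist_le x 0
  rw [h7] at this
  simpa using this

theorem PropertyStar.exists_approx {C : ℝ} (h : PropertyStar X C) (hC : 0 ≤ C) {f : X → ℝ}
    {L : ℝ} (hL : 0 ≤ L) (hf : ∀ x y, |f x - f y| ≤ L * dist x y) {ε : ℝ} (hε : 0 < ε) :
    ∃ K : X → ℝ, ContDiff ℝ 1 K ∧ (∀ x, |f x - K x| < ε) ∧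
      (∀ x y, |K x - K y| ≤ C * L * dist x y) ∧ ∀ x, ‖fderiv ℝ K x‖ ≤ C * L := by
  obtain ⟨h0, h0'⟩ := isLip_and_lipConst_le hL hf
  obtain ⟨K, h1, h2, h3, h4⟩ := h f h0 ε hε
  have h5 : lipConst K ≤ C * L := h4.trans (mul_le_mul_of_nonneg_left h0' hC)
  have h6 : ∀ x y, |K x - K y| ≤ C * L * dist x y := fun x y =>
    (h2.dist_le x y).trans (mul_le_mul_of_nonneg_right h5 dist_nonneg)
  refine ⟨K, h1, h3, h6, fun x => ?_⟩
  have h7 := norm_fderiv_le_of_lipschitz ℝ (x₀ := x)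
    (lipschitzWith_of_abs_sub_le (mul_nonneg hC hL) h6)
  rwa [Real.coe_toNNReal _ (mul_nonneg hC hL)] at h7

/-- A `C¹` function with values in `[0, 1]` and bounded derivative. -/
def IsUnitC1 (g : X → ℝ) : Prop :=
  ContDiff ℝ 1 g ∧ (∀ x, 0 ≤ g x ∧ g x ≤ 1) ∧ ∃ L : ℝ, ∀ x, ‖fderiv ℝ g x‖ ≤ L

theorem IsUnitC1.mul {g h : X → ℝ} (hg : IsUnitC1 g) (hh : IsUnitC1 h) :
    IsUnitC1 fun x => g x * h x := by
  obtain ⟨g1, g2, L, g3⟩ := hg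
  obtain ⟨h1, h2, L', h3⟩ := hh
  refine ⟨g1.mul h1, fun x => ⟨mul_nonneg (g2 x).1 (h2 x).1,
    mul_le_one₀ (g2 x).2 (h2 x).1 (h2 x).2⟩, L' + L, fun x => ?_⟩
  rw [fderiv_fun_mul (g1.differentiable one_ne_zero x) (h1.differentiable one_ne_zero x)]
  refine (norm_add_le _ _).trans (add_le_add ?_ ?_)
  · rw [norm_smul, Real.norm_of_nonneg (g2 x).1]
    exact (mul_le_of_le_one_left (norm_nonneg _) (g2 x).2).trans (h3 x)
  · rw [norm_smul, Real.norm_of_nonneg (h2 x).1]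
    exact (mul_le_of_le_one_left (norm_nonneg _) (h2 x).2).trans (g3 x)

theorem isUnitC1_const {c : ℝ} (h0 : 0 ≤ c) (h1 : c ≤ 1) : IsUnitC1 fun _ : X => c :=
  ⟨contDiff_const, fun _ => ⟨h0, h1⟩, 0, fun x => by simp⟩

theorem IsUnitC1.one_sub {g : X → ℝ} (hg : IsUnitC1 g) : IsUnitC1 fun x => 1 - g x := by
  obtain ⟨g1, g2, L, g3⟩ := hg
  refine ⟨contDiff_const.sub g1, fun x => ⟨by linarith [(g2 x).2], by linarith [(g2 x).1]⟩, L,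
    fun x => ?_⟩
  rw [fderiv_const_sub, norm_neg]
  exact g3 x

theorem IsUnitC1.prod_one_sub {g : ℕ → X → ℝ} (hg : ∀ n, IsUnitC1 (g n)) (n : ℕ) :
    IsUnitC1 fun x => ∏ k ∈ Finset.range n, (1 - g k x) := by
  induction n with
  | zero => simpa using isUnitC1_const (X := X) zero_le_one le_rfl
  | succ n ih =>
    simp only [Finset.prod_range_succ]
    exact ih.mul (hg n).one_sub

theorem exists_bound_deriv_smoothTransition :
    ∃ B : ℝ, 0 ≤ B ∧ ∀ t, |deriv Real.smoothTransition t| ≤ B := by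
  have hc : Continuous (deriv Real.smoothTransition) :=
    (Real.smoothTransition.contDiff (n := 1)).continuous_deriv le_rfl
  obtain ⟨B, hB⟩ := (isCompact_Icc (a := (0 : ℝ)) (b := 1)).exists_bound_of_continuousOn
    hc.continuousOn
  refine ⟨max B 0, le_max_right _ _, fun t => ?_⟩
  by_cases ht : t ∈ Set.Icc (0 : ℝ) 1
  · exact (hB t ht).trans (le_max_left _ _)
  · have : deriv Real.smoothTransition t = 0 := by
      rw [Set.mem_Icc, not_and_or, not_le, not_le] at ht
      rcases ht with ht | ht
      · have : Real.smoothTransition =ᶠ[𝓝 t] fun _ => 0 := by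
          filter_upwards [Iio_mem_nhds ht] with s hs
          exact Real.smoothTransition.zero_of_nonpos (le_of_lt hs)
        simp [this.deriv_eq]
      · have : Real.smoothTransition =ᶠ[𝓝 t] fun _ => 1 := by
          filter_upwards [Ioi_mem_nhds ht] with s hs
          exact Real.smoothTransition.one_of_one_le (le_of_lt hs)
        simp [this.deriv_eq]
    simp [this]

/-- Smooth the distance to `S` to within `δ / 8`, then compose with a step that is `1` below `δ / 4`
and `0` above `3 * δ / 4`; the slack makes both values persist on neighbourhoods. -/
theorem PropertyStar.exists_bump {C : ℝ} (h : PropertyStar X C) (hC : 0 ≤ C) (S : Set X)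
    {δ : ℝ} (hδ : 0 < δ) :
    ∃ g : X → ℝ, IsUnitC1 g ∧ (∀ s ∈ S, ∀ᶠ y in 𝓝 s, g y = 1) ∧
      ∀ x, (∀ s ∈ S, δ ≤ dist x s) → ∀ᶠ y in 𝓝 x, g y = 0 := by
  rcases S.eq_empty_or_nonempty with rfl | hS
  · exact ⟨fun _ => 0, isUnitC1_const le_rfl zero_le_one, by simp, by simp⟩
  have hlip : ∀ x y, |Metric.infDist x S - Metric.infDist y S| ≤ 1 * dist x y := fun x y => by
    simpa [Real.dist_eq] using (Metric.lipschitz_infDist_pt S).dist_le_mul x y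
  obtain ⟨K, h1, h2, -, h4⟩ := h.exists_approx hC zero_le_one hlip (ε := δ / 8) (by positivity)
  obtain ⟨B, hB0, hB⟩ := exists_bound_deriv_smoothTransition
  have hlin : ∀ x, HasFDerivAt (fun x => (3 * δ / 4 - K x) / (δ / 2))
      ((δ / 2)⁻¹ • -fderiv ℝ K x) x := fun x => by
    simp only [div_eq_inv_mul _ (δ / 2)]
    exact ((h1.differentiable one_ne_zero x).hasFDerivAt.const_sub _).const_mul _
  refine ⟨fun x => Real.smoothTransition ((3 * δ / 4 - K x) / (δ / 2)), ⟨?_, fun x =>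
    ⟨Real.smoothTransition.nonneg _, Real.smoothTransition.le_one _⟩,
    B * ((δ / 2)⁻¹ * (C * 1)), fun x => ?_⟩, fun s hs => ?_, fun x hx => ?_⟩
  · exact Real.smoothTransition.contDiff.comp ((contDiff_const.sub h1).div_const _)
  · have hd : HasDerivAt Real.smoothTransition _ ((3 * δ / 4 - K x) / (δ / 2)) :=
      ((Real.smoothTransition.contDiff (n := 1)).differentiable one_ne_zero _).hasDerivAt
    have := (hd.comp_hasFDerivAt x (hlin x)).fderiv
    simp only [Function.comp_def] at this
    rw [this, norm_smul, norm_smul, norm_neg, norm_inv, Real.norm_of_nonneg (by positivity :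
      0 ≤ δ / 2)]
    gcongr
    · exact hB _
    · exact h4 x
  · have : K s < δ / 4 := by
      have := (abs_lt.1 (h2 s)).1
      rw [Metric.infDist_zero_of_mem hs] at this
      linarith
    filter_upwards [h1.continuous.continuousAt.eventually_lt continuousAt_const this] with y hy
    apply Real.smoothTransition.one_of_one_le
    rw [le_div_iff₀ (by positivity)]
    linarith
  · have hx' : δ ≤ Metric.infDist x S := (Metric.le_infDist hS).2 fun {s} hs => hx s hs
    have : 3 * δ / 4 < K x := by
      have := (abs_lt.1 (h2 x)).2
      linarith
    filter_upwards [continuousAt_const.eventually_lt h1.continuous.continuousAt this] with y hy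
    apply Real.smoothTransition.zero_of_nonpos
    exact div_nonpos_of_nonpos_of_nonneg (by linarith) (by positivity)

/-- A countable `C¹` partition of unity `ψ` with bounds `L` on the derivatives; near every point
of its support `ψ n` is controlled by the set `U (i n x)`, and the index `i n` is locally
constant there, with distinct indices being attained only at a uniform distance. -/
structure IsSmoothPartition {ι : Type*} (U : ι → Set X) (ψ : ℕ → X → ℝ) (L : ℕ → ℝ)
    (i : ℕ → X → ι) : Prop where
  contDiff : ∀ n, ContDiff ℝ 1 (ψ n)
  nonneg : ∀ n x, 0 ≤ ψ n x
  one_le : ∀ n, 1 ≤ L n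
  norm_fderiv_le : ∀ n x, ‖fderiv ℝ (ψ n) x‖ ≤ L n
  finite : ∀ x, ∃ N, ∀ᶠ y in 𝓝 x, (∀ n ≥ N, ψ n y = 0) ∧ ∑ n ∈ Finset.range N, ψ n y = 1
  local_index : ∀ n x, (∀ᶠ y in 𝓝 x, ψ n y = 0) ∨
    (x ∈ U (i n x) ∧ ∀ᶠ y in 𝓝 x, i n y = i n x)
  separated : ∀ n z w, ψ n z ≠ 0 → ψ n w ≠ 0 → i n z ≠ i n w → 2 ≤ L n * dist z w

theorem sum_mul_prod_one_sub (a : ℕ → ℝ) (N : ℕ) :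
    ∑ n ∈ Finset.range N, a n * ∏ k ∈ Finset.range n, (1 - a k) =
      1 - ∏ k ∈ Finset.range N, (1 - a k) := by
  induction N with
  | zero => simp
  | succ N ih => rw [Finset.sum_range_succ, ih, Finset.prod_range_succ]; ring

/-- Assign each point to the first set, in a well-order, that contains it. Points lying deep in sets
with different first indices are far apart, so one bump per depth `δ n` handles all indices at once.
-/
theorem PropertyStar.exists_smoothPartition {C : ℝ} (h : PropertyStar X C) (hC : 0 ≤ C)
    {ι : Type*} {U : ι → Set X} (hU : ∀ i, IsOpen (U i)) (hcov : ∀ x, ∃ i, x ∈ U i) :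
    ∃ ψ L i, IsSmoothPartition U ψ L i := by
  classical
  obtain ⟨_, _⟩ := exists_wellFoundedLT ι
  have hmin : ∀ x, ∃ j, x ∈ U j ∧ ∀ k < j, x ∉ U k := fun x => by
    obtain ⟨j, hj, hj'⟩ := wellFounded_lt.has_min {j | x ∈ U j} (hcov x)
    exact ⟨j, hj, fun k hk hk' => hj' k hk' hk⟩
  choose j hjU hjmin using hmin
  let δ : ℕ → ℝ := fun n => 1 / ((n : ℝ) + 1)
  have hδ : ∀ n, 0 < δ n := fun n => Nat.one_div_pos_of_nat
  -- Of the margin `3 * δ n`, the two neighbourhoods of radius `δ n` use up two thirds, leaving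
  -- separation `δ n`.
  let S : ℕ → Set X := fun n => {x | Metric.ball x (3 * δ n) ⊆ U (j x)}
  have hsep : ∀ n, ∀ s ∈ S n, ∀ t ∈ S n, j s ≠ j t → 3 * δ n ≤ dist s t := by
    intro n s hs t ht hst
    by_contra hlt
    rw [not_le] at hlt
    rcases lt_or_gt_of_ne hst with h' | h'
    · exact hjmin t _ h' (hs (by rwa [Metric.mem_ball, dist_comm]))
    · exact hjmin s _ h' (ht (by rwa [Metric.mem_ball]))
  -- The default value `j x` is harmless: it occurs only where `g n`, hence `ψ n`, vanishes nearby.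
  let i : ℕ → X → ι := fun n x =>
    if hx : ∃ s ∈ S n, dist x s < δ n then j hx.choose else j x
  have hi : ∀ n x, ∀ s ∈ S n, dist x s < δ n → i n x = j s := by
    intro n x s hs hxs
    have hx : ∃ s ∈ S n, dist x s < δ n := ⟨s, hs, hxs⟩
    have : i n x = j hx.choose := dif_pos hx
    rw [this]
    by_contra hne
    have h1 := hsep n _ hx.choose_spec.1 s hs hne
    have h2 := hx.choose_spec.2
    have h3 := dist_triangle_left hx.choose s x
    linarith [hδ n]
  choose g hg hg1 hg0 using fun n => h.exists_bump hC (S n) (hδ n)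
  have hgsupp : ∀ n x, g n x ≠ 0 → ∃ s ∈ S n, dist x s < δ n := by
    intro n x hx
    by_contra! hcon
    exact hx (hg0 n x hcon).self_of_nhds
  have hψ : ∀ n, IsUnitC1 fun x => g n x * ∏ k ∈ Finset.range n, (1 - g k x) := fun n =>
    (hg n).mul (IsUnitC1.prod_one_sub hg n)
  choose hψ1 hψ2 B hB using hψ
  refine ⟨fun n x => g n x * ∏ k ∈ Finset.range n, (1 - g k x),
    fun n => max (max 1 (B n)) (2 / δ n), i, hψ1, fun n x => (hψ2 n x).1, fun n => ?_,
    fun n x => ?_, fun x => ?_, fun n x => ?_, fun n z w hz hw hzw => ?_⟩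
  · exact (le_max_left _ _).trans (le_max_left _ _)
  · exact (hB n x).trans ((le_max_right _ _).trans (le_max_left _ _))
  · obtain ⟨r, hr, hrU⟩ := Metric.isOpen_iff.1 (hU (j x)) x (hjU x)
    obtain ⟨n, hn⟩ := exists_nat_one_div_lt (show 0 < r / 3 by positivity)
    have hxS : x ∈ S n := (Metric.ball_subset_ball (by
      change 3 * (1 / ((n : ℝ) + 1)) ≤ r; linarith)).trans hrU
    refine ⟨n + 1, ?_⟩
    filter_upwards [hg1 n x hxS] with y hy
    -- As `g n = 1` near `x`, the factor `1 - g n` kills all later terms, and the telescoping sum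
    -- equals `1`.
    have hzero : ∀ m ≥ n + 1, ∏ k ∈ Finset.range m, (1 - g k y) = 0 := fun m hm =>
      Finset.prod_eq_zero (Finset.mem_range.2 hm) (by rw [hy, sub_self])
    refine ⟨fun m hm => by rw [hzero m hm, mul_zero], ?_⟩
    rw [sum_mul_prod_one_sub (fun k => g k y), hzero _ le_rfl, sub_zero]
  · by_cases hx : ∃ s ∈ S n, dist x s < δ n
    · right
      obtain ⟨s, hs, hxs⟩ := hx
      rw [hi n x s hs hxs]
      refine ⟨hs (Metric.mem_ball.2 (by linarith [hδ n])), ?_⟩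
      filter_upwards [Metric.isOpen_ball.mem_nhds (Metric.mem_ball.2 hxs)] with y hy
      exact hi n y s hs hy
    · left
      push Not at hx
      filter_upwards [hg0 n x hx] with y hy
      rw [hy, zero_mul]
  · obtain ⟨s, hs, hzs⟩ := hgsupp n z (left_ne_zero_of_mul hz)
    obtain ⟨t, ht, hwt⟩ := hgsupp n w (left_ne_zero_of_mul hw)
    rw [hi n z s hs hzs, hi n w t ht hwt] at hzw
    have h1 := hsep n s hs t ht hzw
    have h2 : dist s t ≤ dist s z + dist z w + dist w t := dist_triangle4 _ _ _ _
    rw [dist_comm s z] at h2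
    have h3 : δ n ≤ dist z w := by linarith
    calc (2 : ℝ) = 2 / δ n * δ n := (div_mul_cancel₀ _ (hδ n).ne').symm
      _ ≤ _ := mul_le_mul (le_max_right _ _) h3 (hδ n).le
        ((zero_le_one.trans (le_max_left _ _)).trans (le_max_left _ _))

end Star

/-! ### Gluing local approximants. -/

section Glue

variable {X : Type*} [NormedAddCommGroup X] [NormedSpace ℝ X]

theorem norm_sum_smul_sub_le {E : Type*} [SeminormedAddCommGroup E] [NormedSpace ℝ E]
    {s : Finset ℕ} {a : ℕ → ℝ} {v : ℕ → E} {u : E} {c : ℝ} (ha : ∀ n, 0 ≤ a n)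
    (h1 : ∑ n ∈ s, a n = 1) (hv : ∀ n, a n ≠ 0 → ‖v n - u‖ ≤ c) :
    ‖∑ n ∈ s, a n • v n - u‖ ≤ c := by
  have : ∑ n ∈ s, a n • v n - u = ∑ n ∈ s, a n • (v n - u) := by
    simp only [smul_sub, Finset.sum_sub_distrib, ← Finset.sum_smul, h1, one_smul]
  rw [this]
  calc _ ≤ ∑ n ∈ s, a n * c := norm_sum_le_of_le _ fun n _ => by
        rw [norm_smul, Real.norm_of_nonneg (ha n)]
        by_cases h : a n = 0
        · simp [h]
        · exact mul_le_mul_of_nonneg_left (hv n h) (ha n)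
    _ = c := by rw [← Finset.sum_mul, h1, one_mul]

/-- The sum of the functions `Δ n (i n x)` weighted by a partition of unity. -/
noncomputable def glue {ι : Type*} (ψ : ℕ → X → ℝ) (i : ℕ → X → ι) (Δ : ℕ → ι → X → ℝ)
    (x : X) : ℝ :=
  ∑' n, ψ n x * Δ n (i n x) x

namespace IsSmoothPartition

variable {ι : Type*} {U : ι → Set X} {ψ : ℕ → X → ℝ} {L : ℕ → ℝ} {i : ℕ → X → ι}

theorem mem_of_ne_zero (P : IsSmoothPartition U ψ L i) {n : ℕ} {x : X} (h : ψ n x ≠ 0) :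
    x ∈ U (i n x) :=
  (P.local_index n x).elim (fun h' => absurd h'.self_of_nhds h) And.left

theorem le_one (P : IsSmoothPartition U ψ L i) (n : ℕ) (x : X) : ψ n x ≤ 1 := by
  obtain ⟨N, hN⟩ := P.finite x
  obtain ⟨h0, h1⟩ := hN.self_of_nhds
  by_cases hn : n < N
  · rw [← h1]
    exact Finset.single_le_sum (fun m _ => P.nonneg m x) (Finset.mem_range.2 hn)
  · rw [h0 n (not_lt.1 hn)]
    exact zero_le_one

theorem abs_sub_le (P : IsSmoothPartition U ψ L i) (n : ℕ) (x y : X) :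
    |ψ n x - ψ n y| ≤ L n * ‖x - y‖ :=
  convex_univ.norm_image_sub_le_of_norm_fderiv_le
    (fun z _ => (P.contDiff n).differentiable one_ne_zero z)
    (fun z _ => P.norm_fderiv_le n z) (Set.mem_univ y) (Set.mem_univ x)

theorem exists_sum_eq_one (P : IsSmoothPartition U ψ L i) (Δ : ℕ → ι → X → ℝ) (x : X) :
    ∃ N, ∀ M ≥ N, ∑ n ∈ Finset.range M, ψ n x = 1 ∧
      glue ψ i Δ x = ∑ n ∈ Finset.range M, ψ n x * Δ n (i n x) x := by
  obtain ⟨N, hN⟩ := P.finite x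
  obtain ⟨h0, h1⟩ := hN.self_of_nhds
  refine ⟨N, fun M hM => ⟨?_, ?_⟩⟩
  · rw [← h1]
    refine (Finset.sum_subset (Finset.range_mono hM) fun n _ hn => h0 n ?_).symm
    simpa using hn
  · refine tsum_eq_sum fun n hn => ?_
    rw [h0 n (hM.trans (by simpa using hn)), zero_mul]

/-- Near `x` each index `i n` may be frozen, since it is locally constant wherever `ψ n` is not
locally zero. The glued function is thus locally a finite sum of products. -/
theorem eventually_glue_eq (P : IsSmoothPartition U ψ L i) (Δ : ℕ → ι → X → ℝ) (x : X) :
    ∃ N, (∀ᶠ y in 𝓝 x, ∑ n ∈ Finset.range N, ψ n y = 1) ∧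
      ∀ᶠ y in 𝓝 x, glue ψ i Δ y = ∑ n ∈ Finset.range N, ψ n y * Δ n (i n x) y := by
  obtain ⟨N, hN⟩ := P.finite x
  refine ⟨N, hN.mono fun y hy => hy.2, ?_⟩
  have h : ∀ᶠ y in 𝓝 x, ∀ n ∈ Finset.range N,
      ψ n y * Δ n (i n y) y = ψ n y * Δ n (i n x) y := by
    refine (Finset.eventually_all _).2 fun n _ => ?_
    rcases P.local_index n x with h | ⟨-, h⟩
    · filter_upwards [h] with y hy
      simp [hy]
    · filter_upwards [h] with y hy
      rw [hy]
  filter_upwards [hN, h] with y hy hy'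
  rw [← Finset.sum_congr rfl hy']
  refine tsum_eq_sum fun n hn => ?_
  rw [hy.1 n (by simpa using hn), zero_mul]

variable {Δ : ℕ → ι → X → ℝ}

theorem contDiff_glue (P : IsSmoothPartition U ψ L i) (hΔ : ∀ n k, ContDiff ℝ 1 (Δ n k)) :
    ContDiff ℝ 1 (glue ψ i Δ) := by
  refine contDiff_iff_contDiffAt.2 fun x => ?_
  obtain ⟨N, -, hN⟩ := P.eventually_glue_eq Δ x
  refine ContDiffAt.congr_of_eventuallyEq ?_ hN
  have : ContDiff ℝ 1 fun y => ∑ n ∈ Finset.range N, ψ n y * Δ n (i n x) y :=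
    ContDiff.sum fun n _ => (P.contDiff n).mul (hΔ n _)
  exact this.contDiffAt

theorem abs_sub_glue_le (P : IsSmoothPartition U ψ L i) {F : X → ℝ} {x : X} {c : ℝ}
    (hc : ∀ n k, x ∈ U k → |F x - Δ n k x| ≤ c) : |F x - glue ψ i Δ x| ≤ c := by
  obtain ⟨N, hN⟩ := P.exists_sum_eq_one Δ x
  obtain ⟨h1, h2⟩ := hN N le_rfl
  rw [h2, abs_sub_comm]
  refine norm_sum_smul_sub_le (v := fun n => Δ n (i n x) x) (fun n => P.nonneg n x) h1
    fun n hn => ?_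
  rw [Real.norm_eq_abs, abs_sub_comm]
  exact hc n _ (P.mem_of_ne_zero hn)

theorem norm_fderiv_glue_sub_le (P : IsSmoothPartition U ψ L i)
    (hΔ : ∀ n k, ContDiff ℝ 1 (Δ n k)) {F : X → ℝ} {e : ℕ → ℝ} (he : ∀ n, 0 ≤ e n)
    (x : X) (hF : ∀ n k, x ∈ U k → |F x - Δ n k x| ≤ e n) :
    ∃ N, ∑ n ∈ Finset.range N, ψ n x = 1 ∧
      ‖fderiv ℝ (glue ψ i Δ) x - ∑ n ∈ Finset.range N, ψ n x • fderiv ℝ (Δ n (i n x)) x‖ ≤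
        ∑ n ∈ Finset.range N, L n * e n := by
  obtain ⟨N, h1, h2⟩ := P.eventually_glue_eq Δ x
  refine ⟨N, h1.self_of_nhds, ?_⟩
  have hψ : ∀ n, HasFDerivAt (ψ n) (fderiv ℝ (ψ n) x) x := fun n =>
    ((P.contDiff n).differentiable one_ne_zero x).hasFDerivAt
  -- The weights sum to `1` near `x`, so `F x` may be subtracted from every coefficient of `fderiv ℝ
  -- (ψ n) x` for free.
  have h0 : ∑ n ∈ Finset.range N, fderiv ℝ (ψ n) x = 0 := by
    have hs : HasFDerivAt (fun y => ∑ n ∈ Finset.range N, ψ n y) _ x :=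
      HasFDerivAt.fun_sum fun n _ => hψ n
    rw [← hs.fderiv, Filter.EventuallyEq.fderiv_eq (f₁ := fun y => ∑ n ∈ Finset.range N, ψ n y)
      (f := fun _ => (1 : ℝ)) h1]
    simp
  have h3 : fderiv ℝ (glue ψ i Δ) x = ∑ n ∈ Finset.range N,
      (ψ n x • fderiv ℝ (Δ n (i n x)) x + Δ n (i n x) x • fderiv ℝ (ψ n) x) := by
    rw [Filter.EventuallyEq.fderiv_eq h2]
    exact (HasFDerivAt.fun_sum fun n _ =>
      (hψ n).mul ((hΔ n _).differentiable one_ne_zero x).hasFDerivAt).fderiv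
  have h4 : fderiv ℝ (glue ψ i Δ) x - ∑ n ∈ Finset.range N, ψ n x • fderiv ℝ (Δ n (i n x)) x =
      ∑ n ∈ Finset.range N, (Δ n (i n x) x - F x) • fderiv ℝ (ψ n) x := by
    rw [h3, Finset.sum_add_distrib, add_sub_cancel_left]
    simp only [sub_smul, Finset.sum_sub_distrib, ← Finset.smul_sum, h0, smul_zero, sub_zero]
  rw [h4]
  refine norm_sum_le_of_le _ fun n _ => ?_
  have hL : 0 ≤ L n := zero_le_one.trans (P.one_le n)
  rcases P.local_index n x with h | ⟨h, -⟩
  · rw [Filter.EventuallyEq.fderiv_eq (f₁ := ψ n) (f := fun _ => (0 : ℝ)) h]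
    simpa using mul_nonneg hL (he n)
  · rw [norm_smul, mul_comm, Real.norm_eq_abs, abs_sub_comm]
    exact mul_le_mul (P.norm_fderiv_le n x) (hF n _ h) (abs_nonneg _) hL

/-- If both points use the same piece, split as in the product rule. If one weight vanishes, the
other is at most `L n * ‖z - w‖`. If the pieces differ, the points are so far apart that the crude
bound `2 * e n` suffices. -/
theorem abs_mul_sub_mul_le (P : IsSmoothPartition U ψ L i) {F : X → ℝ} {e : ℕ → ℝ}
    (hF : ∀ n k, ∀ x ∈ U k, |F x - Δ n k x| ≤ e n) {κ : ℝ} {z w : X}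
    (hκ : ∀ n k, z ∈ U k → w ∈ U k →
      |(F z - Δ n k z) - (F w - Δ n k w)| ≤ κ * ‖z - w‖) (he : ∀ n, 0 ≤ e n) (hκ0 : 0 ≤ κ)
    (n : ℕ) :
    |ψ n z * (F z - Δ n (i n z) z) - ψ n w * (F w - Δ n (i n w) w)| ≤
      (ψ n z * κ + L n * e n) * ‖z - w‖ := by
  have hψ := P.abs_sub_le n z w
  have hL : 0 ≤ L n := zero_le_one.trans (P.one_le n)
  have hz0 := P.nonneg n z
  have hw0 := P.nonneg n w
  have hd := norm_nonneg (z - w)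
  have hLe := mul_nonneg hL (he n)
  by_cases hz : ψ n z = 0
  · by_cases hw : ψ n w = 0
    · simp only [hz, hw, zero_mul, sub_zero, abs_zero, zero_add]
      positivity
    · have := hF n _ w (P.mem_of_ne_zero hw)
      rw [hz, zero_sub, abs_neg, abs_of_nonneg hw0] at hψ
      rw [hz, zero_mul, zero_sub, abs_neg, abs_mul, abs_of_nonneg hw0, zero_mul, zero_add]
      calc _ ≤ (L n * ‖z - w‖) * e n := mul_le_mul hψ this (abs_nonneg _) (mul_nonneg hL hd)
        _ = _ := by ring
  have hFz := hF n _ z (P.mem_of_ne_zero hz)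
  by_cases hw : ψ n w = 0
  · rw [hw, sub_zero, abs_of_nonneg hz0] at hψ
    rw [hw, zero_mul, sub_zero, abs_mul, abs_of_nonneg hz0]
    calc _ ≤ (L n * ‖z - w‖) * e n := mul_le_mul hψ hFz (abs_nonneg _) (mul_nonneg hL hd)
      _ = L n * e n * ‖z - w‖ := by ring
      _ ≤ _ := mul_le_mul_of_nonneg_right (le_add_of_nonneg_left (mul_nonneg hz0 hκ0)) hd
  have hFw := hF n _ w (P.mem_of_ne_zero hw)
  by_cases hi : i n z = i n w
  · have h1 := hκ n (i n z) (P.mem_of_ne_zero hz) (hi ▸ P.mem_of_ne_zero hw)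
    rw [← hi] at hFw ⊢
    have h2 : ψ n z * (F z - Δ n (i n z) z) - ψ n w * (F w - Δ n (i n z) w) =
        ψ n z * ((F z - Δ n (i n z) z) - (F w - Δ n (i n z) w)) +
          (ψ n z - ψ n w) * (F w - Δ n (i n z) w) := by ring
    rw [h2]
    refine (abs_add_le _ _).trans ?_
    rw [abs_mul, abs_mul, abs_of_nonneg hz0]
    calc _ ≤ ψ n z * (κ * ‖z - w‖) + (L n * ‖z - w‖) * e n :=
          add_le_add (mul_le_mul_of_nonneg_left h1 hz0)
            (mul_le_mul hψ hFw (abs_nonneg _) (mul_nonneg hL hd))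
      _ = _ := by ring
  · have h1 := P.separated n z w hz hw hi
    rw [dist_eq_norm] at h1
    refine (abs_sub _ _).trans ?_
    rw [abs_mul, abs_mul, abs_of_nonneg hz0, abs_of_nonneg hw0]
    calc _ ≤ 1 * e n + 1 * e n :=
          add_le_add (mul_le_mul (P.le_one n z) hFz (abs_nonneg _) zero_le_one)
            (mul_le_mul (P.le_one n w) hFw (abs_nonneg _) zero_le_one)
      _ = 2 * e n := by ring
      _ ≤ (L n * ‖z - w‖) * e n := mul_le_mul_of_nonneg_right h1 (he n)
      _ = L n * e n * ‖z - w‖ := by ring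
      _ ≤ _ := mul_le_mul_of_nonneg_right (le_add_of_nonneg_left (mul_nonneg hz0 hκ0)) hd

theorem abs_sub_glue_sub_le (P : IsSmoothPartition U ψ L i) {F : X → ℝ} {e : ℕ → ℝ}
    (hF : ∀ n k, ∀ x ∈ U k, |F x - Δ n k x| ≤ e n) {κ : ℝ} {z w : X}
    (hκ : ∀ n k, z ∈ U k → w ∈ U k →
      |(F z - Δ n k z) - (F w - Δ n k w)| ≤ κ * ‖z - w‖) (he : ∀ n, 0 ≤ e n) (hκ0 : 0 ≤ κ)
    {c : ℝ} (hc : ∀ N, ∑ n ∈ Finset.range N, L n * e n ≤ c) :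
    |(F z - glue ψ i Δ z) - (F w - glue ψ i Δ w)| ≤ (κ + c) * ‖z - w‖ := by
  obtain ⟨N₁, hN₁⟩ := P.exists_sum_eq_one Δ z
  obtain ⟨N₂, hN₂⟩ := P.exists_sum_eq_one Δ w
  obtain ⟨hz, hGz⟩ := hN₁ (max N₁ N₂) (le_max_left _ _)
  obtain ⟨hw, hGw⟩ := hN₂ (max N₁ N₂) (le_max_right _ _)
  set N := max N₁ N₂
  have h : (F z - glue ψ i Δ z) - (F w - glue ψ i Δ w) = ∑ n ∈ Finset.range N,
      (ψ n z * (F z - Δ n (i n z) z) - ψ n w * (F w - Δ n (i n w) w)) := by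
    simp only [mul_sub, Finset.sum_sub_distrib, ← Finset.sum_mul, hz, hw, hGz, hGw, one_mul]
  rw [h]
  calc _ ≤ ∑ n ∈ Finset.range N, (ψ n z * κ + L n * e n) * ‖z - w‖ :=
        (Finset.abs_sum_le_sum_abs _ _).trans (Finset.sum_le_sum fun n _ =>
          P.abs_mul_sub_mul_le hF hκ he hκ0 n)
    _ = (κ + ∑ n ∈ Finset.range N, L n * e n) * ‖z - w‖ := by
        rw [← Finset.sum_mul, Finset.sum_add_distrib, ← Finset.sum_mul, hz, one_mul]
    _ ≤ _ := by gcongr; exact hc N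

end IsSmoothPartition

/-- Glue the constants `F p` over the sets where `F` is close to `F p`. -/
theorem PropertyStar.exists_contDiff_approx {C : ℝ} (h : PropertyStar X C) (hC : 0 ≤ C)
    {F : X → ℝ} (hF : Continuous F) {ε : ℝ} (hε : 0 < ε) :
    ∃ G : X → ℝ, ContDiff ℝ 1 G ∧ ∀ x, |F x - G x| < ε := by
  obtain ⟨ψ, L, i, P⟩ := h.exists_smoothPartition hC
    (U := fun p : X => {x | |F x - F p| < ε / 2})
    (fun p => isOpen_lt (by fun_prop) continuous_const) (fun x => ⟨x, by simpa using hε⟩)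
  refine ⟨glue ψ i fun _ p _ => F p, P.contDiff_glue fun _ _ => contDiff_const, fun x => ?_⟩
  have := P.abs_sub_glue_le (Δ := fun _ p _ => F p) (F := F) (x := x) (c := ε / 2)
    fun _ k hk => le_of_lt hk
  linarith

end Glue

/-! ### A smooth truncation of the line. -/

section Truncation

/-- Integrate a continuous trapezoid that is `1` on `[-a, a]` and `0` outside `[-2a, 2a]`. -/
theorem exists_truncation {a : ℝ} (ha : 0 < a) :
    ∃ ρ : ℝ → ℝ, ContDiff ℝ 1 ρ ∧ (∀ t, |t| ≤ a → ρ t = t) ∧ (∀ t, |ρ t| ≤ 2 * a) ∧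
      ∀ t, |deriv ρ t| ≤ 1 := by
  let m : ℝ → ℝ := fun u => max 0 (min 1 (2 - |u| / a))
  have hm : Continuous m := by fun_prop
  have hm0 : ∀ u, 0 ≤ m u := fun u => le_max_left _ _
  have hm1 : ∀ u, m u ≤ 1 := fun u => max_le zero_le_one (min_le_left _ _)
  have hm_one : ∀ u, |u| ≤ a → m u = 1 := fun u hu => by
    have : |u| / a ≤ 1 := (div_le_one ha).2 hu
    simp only [m]
    rw [min_eq_left (by linarith), max_eq_right zero_le_one]
  have hm_zero : ∀ u, 2 * a ≤ |u| → m u = 0 := fun u hu => by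
    have : 2 ≤ |u| / a := (le_div_iff₀ ha).2 hu
    exact max_eq_left ((min_le_right _ _).trans (by linarith))
  have hd : ∀ t, HasDerivAt (fun t => ∫ u in (0 : ℝ)..t, m u) (m t) t := fun t =>
    hm.integral_hasStrictDerivAt 0 t |>.hasDerivAt
  have hd' : deriv (fun t => ∫ u in (0 : ℝ)..t, m u) = m := funext fun t => (hd t).deriv
  have hle : ∀ t, |∫ u in (0 : ℝ)..t, m u| ≤ |t| := fun t => by
    simpa using intervalIntegral.norm_integral_le_of_norm_le_const (a := 0) (b := t) (f := m)
      (C := 1) fun u _ => by rw [Real.norm_of_nonneg (hm0 u)]; exact hm1 u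
  have hint : ∀ p q : ℝ, IntervalIntegrable m MeasureTheory.volume p q := fun p q =>
    hm.intervalIntegrable p q
  refine ⟨fun t => ∫ u in (0 : ℝ)..t, m u, ?_, fun t ht => ?_, fun t => ?_, fun t => ?_⟩
  · rw [contDiff_one_iff_deriv, hd']
    exact ⟨fun t => (hd t).differentiableAt, hm⟩
  · have : Set.EqOn m (fun _ => 1) (Set.uIcc 0 t) := fun u hu => hm_one u (by
      have := Set.abs_sub_left_of_mem_uIcc hu
      simp only [sub_zero] at this
      exact this.trans ht)
    simp only
    rw [intervalIntegral.integral_congr this]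
    simp
  · rcases le_total (|t|) (2 * a) with ht | ht
    · exact (hle t).trans ht
    · have key : ∀ b, |b| = 2 * a → Set.EqOn m (fun _ => 0) (Set.uIcc b t) →
          |∫ u in (0 : ℝ)..t, m u| ≤ 2 * a := fun b hb hbt => by
        rw [← intervalIntegral.integral_add_adjacent_intervals (hint 0 b) (hint b t),
          intervalIntegral.integral_congr hbt]
        simpa [hb] using hle b
      rcases le_abs'.1 ht with h | h
      · refine key (-(2 * a)) (by rw [abs_neg, abs_of_pos (by positivity)]) fun u hu => ?_
        rw [Set.uIcc_of_ge h] at hu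
        exact hm_zero u (le_abs'.2 (Or.inl hu.2))
      · refine key (2 * a) (abs_of_pos (by positivity)) fun u hu => ?_
        rw [Set.uIcc_of_le h] at hu
        exact hm_zero u (le_abs'.2 (Or.inr hu.1))
  · rw [hd', abs_of_nonneg (hm0 t)]
    exact hm1 t

end Truncation

/-! ### Local approximants and their assembly. -/

section Main

variable {X : Type*} [NormedAddCommGroup X] [NormedSpace ℝ X]

/-- `K` smooths a McShane extension of `H` from `A`, so it has good slope but is close to `H` only
on `A`; `φ` is close to `H` everywhere. The function `φ + ρ (K - φ)` equals `K` near `A` and stays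
close to `φ` everywhere. -/
theorem PropertyStar.exists_approx_of_lipschitzOn {C : ℝ} (h : PropertyStar X C) (hC : 0 ≤ C)
    {H φ : X → ℝ} {A : Set X} {κ : ℝ} (hκ : 0 ≤ κ)
    (hA : ∀ a ∈ A, ∀ b ∈ A, |H a - H b| ≤ κ * dist a b) {ε : ℝ} (hε : 0 < ε)
    (hφ : ContDiff ℝ 1 φ) (hHφ : ∀ x, |H x - φ x| < ε / 5) :
    ∃ δ : X → ℝ, ContDiff ℝ 1 δ ∧ (∀ x, |H x - δ x| < ε) ∧
      (∀ a ∈ A, ‖fderiv ℝ δ a‖ ≤ C * κ) ∧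
      (∀ a ∈ A, ∀ b ∈ A, |δ a - δ b| ≤ C * κ * dist a b) ∧
      ∀ l, (∀ x, ‖fderiv ℝ φ x‖ ≤ l) → ∀ x, ‖fderiv ℝ δ x‖ ≤ 2 * l + C * κ := by
  have hlip : LipschitzOnWith κ.toNNReal H A := LipschitzOnWith.of_dist_le_mul
    fun a ha b hb => by
      rw [Real.dist_eq, Real.coe_toNNReal _ hκ]
      exact hA a ha b hb
  obtain ⟨H', hH', hHH'⟩ := hlip.extend_real
  obtain ⟨K, hK, hK1, hK2, hK3⟩ := h.exists_approx hC hκ (f := H') (fun x y => by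
    simpa [Real.dist_eq, Real.coe_toNNReal _ hκ] using hH'.dist_le_mul x y)
    (ε := ε / 5) (by positivity)
  -- On `A` both approximations are within `ε / 5` of `H`, so `|K - φ| < 2 * ε / 5`. As `|ρ| ≤ 4 * ε
  -- / 5`, the total error is below `ε`.
  obtain ⟨ρ, hρ, hρ1, hρ2, hρ3⟩ := exists_truncation (a := 2 * ε / 5) (by positivity)
  have hnear : ∀ a ∈ A, |K a - φ a| < 2 * ε / 5 := fun a ha => by
    have h1 := abs_lt.1 (hHφ a)
    have h2 := abs_lt.1 (hK1 a)
    rw [← hHH' ha] at h2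
    rw [abs_lt]
    constructor <;> linarith
  have heq : ∀ a ∈ A, (fun x => φ x + ρ (K x - φ x)) =ᶠ[𝓝 a] K := fun a ha => by
    have hc : Continuous fun x => |K x - φ x| := (hK.continuous.sub hφ.continuous).abs
    filter_upwards [hc.continuousAt.eventually_lt continuousAt_const (hnear a ha)] with x hx
    rw [hρ1 _ hx.le]
    ring
  refine ⟨fun x => φ x + ρ (K x - φ x), hφ.add (hρ.comp (hK.sub hφ)), fun x => ?_,
    fun a ha => ?_, fun a ha b hb => ?_, fun l hl x => ?_⟩
  · have h1 := abs_lt.1 (hHφ x)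
    have h2 := abs_le.1 (hρ2 (K x - φ x))
    rw [abs_lt]
    constructor <;> linarith
  · rw [(heq a ha).fderiv_eq]
    exact hK3 a
  · have ea := (heq a ha).eq_of_nhds
    have eb := (heq b hb).eq_of_nhds
    have hab := hK2 a b
    rw [← ea, ← eb] at hab
    exact hab
  · have hφ' := (hφ.differentiable one_ne_zero x).hasFDerivAt
    have hK' := (hK.differentiable one_ne_zero x).hasFDerivAt
    have hρ' : HasDerivAt ρ _ (K x - φ x) :=
      (hρ.differentiable one_ne_zero _).hasDerivAt
    have hd := (hφ'.add (hρ'.comp_hasFDerivAt x (hK'.sub hφ'))).fderiv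
    have hd' : fderiv ℝ (fun x => φ x + ρ (K x - φ x)) x =
      fderiv ℝ φ x + deriv ρ (K x - φ x) • (fderiv ℝ K x - fderiv ℝ φ x) := hd
    rw [hd']
    have h1 : ‖deriv ρ (K x - φ x) • (fderiv ℝ K x - fderiv ℝ φ x)‖ ≤ C * κ + l := by
      rw [norm_smul]
      calc _ ≤ 1 * ‖fderiv ℝ K x - fderiv ℝ φ x‖ :=
            mul_le_mul_of_nonneg_right (hρ3 _) (norm_nonneg _)
        _ ≤ ‖fderiv ℝ K x‖ + ‖fderiv ℝ φ x‖ := by rw [one_mul]; exact norm_sub_le _ _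
        _ ≤ _ := add_le_add (hK3 x) (hl x)
    have h2 := norm_add_le (fderiv ℝ φ x)
      (deriv ρ (K x - φ x) • (fderiv ℝ K x - fderiv ℝ φ x))
    linarith [hl x]

/-- `C¹` approximation of a continuous function preserving, up to the factor `C`, its Lipschitz
constant on a set and, up to the factor `3 * C`, its Lipschitz constant on the whole space. -/
theorem PropertyStar.exists_approx_preserving_lipschitz {C : ℝ} (h : PropertyStar X C)
    (hC : 0 ≤ C) {H : X → ℝ} (hH : Continuous H) {A : Set X} {κ : ℝ} (hκ : 0 ≤ κ)
    (hA : ∀ a ∈ A, ∀ b ∈ A, |H a - H b| ≤ κ * dist a b) {ε : ℝ} (hε : 0 < ε) :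
    ∃ δ : X → ℝ, ContDiff ℝ 1 δ ∧ (∀ x, |H x - δ x| < ε) ∧
      (∀ a ∈ A, ‖fderiv ℝ δ a‖ ≤ C * κ) ∧
      (∀ a ∈ A, ∀ b ∈ A, |δ a - δ b| ≤ C * κ * dist a b) ∧
      (IsLip H → ∀ x, ‖fderiv ℝ δ x‖ ≤ 3 * (C * lipConst H)) := by
  by_cases hl : IsLip H
  · obtain ⟨φ, hφ, hφ1, -, hφ2⟩ := h.exists_approx hC (lipConst_nonneg H) hl.dist_le
      (ε := ε / 5) (by positivity)
    -- Using the smaller of `κ` and `lipConst H` turns the bound `2 * l + C * κ` into `3 * (C *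
    -- lipConst H)`.
    have hκ' : C * min κ (lipConst H) ≤ C * κ := mul_le_mul_of_nonneg_left (min_le_left _ _) hC
    obtain ⟨δ, h1, h2, h3, h4, h5⟩ := h.exists_approx_of_lipschitzOn hC (A := A)
      (le_min hκ (lipConst_nonneg H)) (fun a ha b hb => by
        rw [min_mul_of_nonneg _ _ dist_nonneg]
        exact le_min (hA a ha b hb) (hl.dist_le a b)) hε hφ hφ1
    refine ⟨δ, h1, h2, fun a ha => (h3 a ha).trans hκ', fun a ha b hb =>
      (h4 a ha b hb).trans (mul_le_mul_of_nonneg_right hκ' dist_nonneg), fun _ x => ?_⟩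
    have := mul_le_mul_of_nonneg_left (min_le_right κ (lipConst H)) hC
    linarith [h5 _ hφ2 x]
  · obtain ⟨φ, hφ, hφ1⟩ := h.exists_contDiff_approx hC hH (ε := ε / 5) (by positivity)
    obtain ⟨δ, h1, h2, h3, h4, -⟩ := h.exists_approx_of_lipschitzOn hC hκ hA hε hφ hφ1
    exact ⟨δ, h1, h2, h3, h4, fun h' => absurd h' hl⟩

/-- Near a point of `Y`, a `C¹` approximation of `F` whose derivative almost agrees with `D`. -/
theorem PropertyStar.exists_local_approx {C : ℝ} (h : PropertyStar X C) (hC : 0 ≤ C)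
    {Y : Set X} {f : Y → ℝ} {D : Y → (diffSpan Y →L[ℝ] ℝ)} {F : X → ℝ} (hF : Continuous F)
    (hFf : ∀ y : Y, F y = f y) {κ : ℝ} (hκ : 0 ≤ κ) {y : Y} {r : ℝ}
    (hE : ∀ z w : Y, (z : X) ∈ Metric.ball (y : X) r → (w : X) ∈ Metric.ball (y : X) r →
      |f z - f w - D y ⟨(z : X) - (w : X), sub_mem_diffSpan z w⟩| ≤ κ * ‖(z : X) - (w : X)‖)
    (hD : ∀ z : Y, (z : X) ∈ Metric.ball (y : X) r → ‖D z - D y‖ ≤ κ) {ε : ℝ} (hε : 0 < ε) :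
    ∃ Δ : X → ℝ, ContDiff ℝ 1 Δ ∧ (∀ x, |F x - Δ x| < ε) ∧
      (∀ z : Y, (z : X) ∈ Metric.ball (y : X) r →
        ‖fderiv ℝ Δ z ∘L (diffSpan Y).subtypeL - D z‖ ≤ (C + 1) * κ) ∧
      (∀ z w : Y, (z : X) ∈ Metric.ball (y : X) r → (w : X) ∈ Metric.ball (y : X) r →
        |(F z - Δ z) - (F w - Δ w)| ≤ (C + 1) * κ * ‖(z : X) - (w : X)‖) ∧
      (IsLip F → ∀ x, ‖fderiv ℝ Δ x‖ ≤ ‖D y‖ + 3 * (C * (‖D y‖ + lipConst F))) := by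
  obtain ⟨T, hT, hTn⟩ := exists_extension_norm_eq (diffSpan Y) (D y)
  have hTD : ∀ z w : Y, T z - T w = D y ⟨(z : X) - (w : X), sub_mem_diffSpan z w⟩ :=
    fun z w => by rw [← hT, map_sub]
  have hA : ∀ a ∈ Y ∩ Metric.ball (y : X) r, ∀ b ∈ Y ∩ Metric.ball (y : X) r,
      |(T a - F a) - (T b - F b)| ≤ κ * dist a b := by
    rintro a ⟨ha, ha'⟩ b ⟨hb, hb'⟩
    have h1 := hE ⟨a, ha⟩ ⟨b, hb⟩ ha' hb'
    rw [← hTD, ← hFf, ← hFf] at h1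
    rw [dist_eq_norm]
    refine le_trans (le_of_eq ?_) h1
    rw [← abs_neg]
    congr 1
    ring
  obtain ⟨δ, h1, h2, h3, h4, h5⟩ := h.exists_approx_preserving_lipschitz hC
    (H := fun x => T x - F x) (T.continuous.sub hF) hκ hA hε
  have hd : ∀ x, fderiv ℝ (fun x => T x - δ x) x = T - fderiv ℝ δ x := fun x =>
    (T.hasFDerivAt.sub (h1.differentiable one_ne_zero x).hasFDerivAt).fderiv
  refine ⟨fun x => T x - δ x, T.contDiff.sub h1, fun x => ?_, fun z hz => ?_,
    fun z w hz hw => ?_, fun hl x => ?_⟩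
  · rw [← abs_neg]
    convert h2 x using 2
    ring
  · have hTy : T ∘L (diffSpan Y).subtypeL = D y := by
      ext v
      exact hT v
    rw [hd, ContinuousLinearMap.sub_comp, hTy]
    have e1 : D y - fderiv ℝ δ z ∘L (diffSpan Y).subtypeL - D z =
        -((D z - D y) + fderiv ℝ δ z ∘L (diffSpan Y).subtypeL) := by abel
    rw [e1, norm_neg (D z - D y + fderiv ℝ δ z ∘L (diffSpan Y).subtypeL)]
    have e2 : ‖fderiv ℝ δ z ∘L (diffSpan Y).subtypeL‖ ≤ C * κ :=
      (ContinuousLinearMap.opNorm_comp_le _ _).trans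
        ((mul_le_of_le_one_right (norm_nonneg _) (Submodule.norm_subtypeL_le _)).trans
          (h3 z ⟨z.2, hz⟩))
    linarith [norm_add_le (D z - D y) (fderiv ℝ δ z ∘L (diffSpan Y).subtypeL), hD z hz]
  · have e1 := hA z ⟨z.2, hz⟩ w ⟨w.2, hw⟩
    have e2 := h4 z ⟨z.2, hz⟩ w ⟨w.2, hw⟩
    rw [dist_eq_norm] at e1 e2
    have e3 : F z - (T z - δ z) - (F w - (T w - δ w)) =
        (δ z - δ w) - ((T z - F z) - (T w - F w)) := by ring
    rw [e3]
    linarith [abs_sub (δ z - δ w) ((T z - F z) - (T w - F w))]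
  · have hlip := isLip_and_lipConst_le (g := fun x => T x - F x) (c := ‖D y‖ + lipConst F)
      (add_nonneg (norm_nonneg (D y)) (lipConst_nonneg F)) fun a b => by
        have e1 : |T a - T b| ≤ ‖D y‖ * dist a b := by
          rw [← map_sub, ← hTn, dist_eq_norm]
          exact T.le_opNorm _
        have e2 := hl.dist_le a b
        have e3 : T a - F a - (T b - F b) = (T a - T b) - (F a - F b) := by ring
        rw [e3]
        linarith [abs_sub (T a - T b) (F a - F b)]
    rw [hd]
    refine (norm_sub_le _ _).trans (add_le_add hTn.le ((h5 hlip.1 x).trans ?_))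
    gcongr
    exact hlip.2

/-- The budget is `ε / 4` from the local pieces, through `(C + 1) * κ`, and `ε / 4` from the
derivatives of the weights. -/
theorem PropertyStar.exists_extension_approx {C : ℝ} (h : PropertyStar X C) (hC : 0 ≤ C)
    {Y : Set X} (hY : IsClosed Y) {f : Y → ℝ} {D : Y → (diffSpan Y →L[ℝ] ℝ)}
    (hD : Continuous D) (hE : ConditionE f D) {F : X → ℝ} (hF : Continuous F)
    (hFf : ∀ y : Y, F y = f y) {ε : ℝ} (hε : 0 < ε) :
    ∃ G : X → ℝ, ContDiff ℝ 1 G ∧ (∀ x, |F x - G x| < ε) ∧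
      (∀ y : Y, ‖D y - fderiv ℝ G y ∘L (diffSpan Y).subtypeL‖ < ε) ∧
      (∀ z w : Y, |(f z - G z) - (f w - G w)| ≤ ε / 2 * dist z w) ∧
      ∀ M, 0 ≤ M → (∀ y, ‖D y‖ ≤ M) → IsLip F →
        ∀ x, ‖fderiv ℝ G x‖ ≤ ε / 4 + (M + 3 * (C * (M + lipConst F))) := by
  obtain ⟨κ, hκ, hκε⟩ : ∃ κ : ℝ, 0 < κ ∧ (C + 1) * κ = ε / 4 :=
    ⟨ε / 4 / (C + 1), by positivity, mul_div_cancel₀ _ (by positivity)⟩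
  have hr : ∀ y : Y, ∃ r > 0,
      (∀ z w : Y, (z : X) ∈ Metric.ball (y : X) r → (w : X) ∈ Metric.ball (y : X) r →
      |f z - f w - D y ⟨(z : X) - (w : X), sub_mem_diffSpan z w⟩| ≤ κ * ‖(z : X) - (w : X)‖) ∧
      ∀ z : Y, (z : X) ∈ Metric.ball (y : X) r → ‖D z - D y‖ ≤ κ := by
    intro y
    obtain ⟨r₁, hr₁, h₁⟩ := hE y κ hκ
    obtain ⟨r₂, hr₂, h₂⟩ := (Metric.continuous_iff (f := D)).1 hD y κ hκ
    refine ⟨min r₁ r₂, lt_min hr₁ hr₂, fun z w hz hw => h₁ z w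
      (Metric.ball_subset_ball (min_le_left _ _) hz)
      (Metric.ball_subset_ball (min_le_left _ _) hw), fun z hz => ?_⟩
    rw [← dist_eq_norm (D z)]
    exact (h₂ z (Metric.ball_subset_ball (min_le_right _ _) hz)).le
  choose r hr0 hrE hrD using hr
  -- The index `none` covers the open complement of `Y`, where all requirements about points of `Y`
  -- are vacuous.
  let U : Option Y → Set X := fun k => k.elim Yᶜ fun y => Metric.ball (y : X) (r y)
  obtain ⟨ψ, L, i, P⟩ := h.exists_smoothPartition hC (U := U)
    (by
      rintro (_ | y)
      · exact hY.isOpen_compl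
      · exact Metric.isOpen_ball)
    (fun x => by
      by_cases hx : x ∈ Y
      · exact ⟨some ⟨x, hx⟩, Metric.mem_ball_self (hr0 _)⟩
      · exact ⟨none, hx⟩)
  have hL : ∀ n, 0 < L n := fun n => zero_lt_one.trans_le (P.one_le n)
  -- Dividing by `L n` makes `∑ L n * e n` a geometric series with sum at most `ε / 4`.
  let e : ℕ → ℝ := fun n => ε / 8 * (1 / 2) ^ n / L n
  have he : ∀ n, 0 < e n := fun n => div_pos (by positivity) (hL n)
  have heL : ∀ n, L n * e n = ε / 8 * (1 / 2) ^ n := fun n => mul_div_cancel₀ _ (hL n).ne'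
  have hesum : ∀ N, ∑ n ∈ Finset.range N, L n * e n ≤ ε / 4 := fun N => by
    simp only [heL, ← Finset.mul_sum]
    have := mul_le_mul_of_nonneg_left (sum_geometric_two_le N) (by positivity : 0 ≤ ε / 8)
    linarith
  have hele : ∀ n, e n ≤ ε / 2 := fun n => by
    have h1 : e n ≤ L n * e n := le_mul_of_one_le_left (he n).le (P.one_le n)
    have h2 : ((1 : ℝ) / 2) ^ n ≤ 1 := pow_le_one₀ (by norm_num) (by norm_num)
    rw [heL] at h1
    nlinarith
  have hloc : ∀ n (k : Option Y), ∃ Δ : X → ℝ, ContDiff ℝ 1 Δ ∧ (∀ x, |F x - Δ x| < e n) ∧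
      (∀ z : Y, (z : X) ∈ U k →
        ‖fderiv ℝ Δ z ∘L (diffSpan Y).subtypeL - D z‖ ≤ (C + 1) * κ) ∧
      (∀ z w : Y, (z : X) ∈ U k → (w : X) ∈ U k →
        |(F z - Δ z) - (F w - Δ w)| ≤ (C + 1) * κ * ‖(z : X) - (w : X)‖) ∧
      ∀ M, 0 ≤ M → (∀ y, ‖D y‖ ≤ M) → IsLip F →
        ∀ x, ‖fderiv ℝ Δ x‖ ≤ M + 3 * (C * (M + lipConst F)) := by
    rintro n (_ | y)
    · obtain ⟨Δ, h1, h2, -, -, h5⟩ := h.exists_approx_preserving_lipschitz hC hF (A := ∅)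
        le_rfl (by simp) (he n)
      refine ⟨Δ, h1, h2, fun z hz => absurd z.2 hz, fun z w hz => absurd z.2 hz,
        fun M hM _ hl x => (h5 hl x).trans ?_⟩
      have := mul_nonneg hC hM
      linarith
    · obtain ⟨Δ, h1, h2, h3, h4, h5⟩ :=
        h.exists_local_approx hC hF hFf hκ.le (hrE y) (hrD y) (he n)
      refine ⟨Δ, h1, h2, h3, h4, fun M hM hDM hl x => (h5 hl x).trans ?_⟩
      gcongr <;> exact hDM y
  choose Δ h1 h2 h3 h4 h5 using hloc
  have hFΔ : ∀ n k, ∀ x ∈ U k, |F x - Δ n k x| ≤ e n := fun n k x _ => (h2 n k x).le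
  refine ⟨glue ψ i Δ, P.contDiff_glue h1, fun x => ?_, fun y => ?_, fun z w => ?_,
    fun M hM hDM hl x => ?_⟩
  · have := P.abs_sub_glue_le (Δ := Δ) (F := F) (x := x) fun n k _ =>
      (h2 n k x).le.trans (hele n)
    linarith
  · obtain ⟨N, hN, hG⟩ := P.norm_fderiv_glue_sub_le h1 (fun n => (he n).le) (y : X)
      fun n k => hFΔ n k y
    have hs := norm_sum_smul_sub_le
      (v := fun n => fderiv ℝ (Δ n (i n y)) y ∘L (diffSpan Y).subtypeL) (u := D y)
      (fun n => P.nonneg n y) hN fun n hn => h3 n _ y (P.mem_of_ne_zero hn)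
    set R := fderiv ℝ (glue ψ i Δ) y - ∑ n ∈ Finset.range N, ψ n y • fderiv ℝ (Δ n (i n y)) y
      with hR
    have hRc : R ∘L (diffSpan Y).subtypeL = fderiv ℝ (glue ψ i Δ) y ∘L (diffSpan Y).subtypeL -
        ∑ n ∈ Finset.range N, ψ n y • fderiv ℝ (Δ n (i n y)) y ∘L (diffSpan Y).subtypeL := by
      rw [hR, ContinuousLinearMap.sub_comp, ContinuousLinearMap.finsetSum_comp]
      simp only [ContinuousLinearMap.smul_comp]
    have hRn : ‖R ∘L (diffSpan Y).subtypeL‖ ≤ ε / 4 :=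
      (ContinuousLinearMap.opNorm_comp_le _ _).trans
        ((mul_le_of_le_one_right (norm_nonneg _) (Submodule.norm_subtypeL_le _)).trans
          (hG.trans (hesum N)))
    rw [norm_sub_rev (D y), ← sub_add_sub_cancel _
      (∑ n ∈ Finset.range N, ψ n y • fderiv ℝ (Δ n (i n y)) y ∘L (diffSpan Y).subtypeL), ← hRc]
    refine (norm_add_le (R ∘L (diffSpan Y).subtypeL) (_ - D y)).trans_lt ?_
    rw [hκε] at hs
    linarith
  · have := P.abs_sub_glue_sub_le (Δ := Δ) hFΔ (fun n k hz hw => h4 n k z w hz hw)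
      (fun n => (he n).le) (by positivity) hesum
    rw [hκε] at this
    rw [← hFf, ← hFf, Subtype.dist_eq, dist_eq_norm]
    convert this using 2
    ring
  · obtain ⟨N, hN, hG⟩ := P.norm_fderiv_glue_sub_le h1 (fun n => (he n).le) x
      fun n k => hFΔ n k x
    have hs := norm_sum_smul_sub_le (v := fun n => fderiv ℝ (Δ n (i n x)) x) (u := 0)
      (fun n => P.nonneg n x) hN fun n _ => by
        rw [sub_zero]; exact h5 n (i n x) M hM hDM hl x
    rw [sub_zero] at hs
    have := norm_sub_norm_le (fderiv ℝ (glue ψ i Δ) x)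
      (∑ n ∈ Finset.range N, ψ n x • fderiv ℝ (Δ n (i n x)) x)
    linarith [hesum N]

end Main

/-! ### Conclusion. -/

theorem mainTheorem5 {X : Type*} [NormedAddCommGroup X] [NormedSpace ℝ X] [CompleteSpace X]
    (C₀ C₁ : ℝ) (hX : PropertyStar X C₀) (hC₁ : C₁ = 33 * C₀)
    (Y : Set X) (hY : IsClosed Y) (f : Y → ℝ)
    (D : Y → (diffSpan Y →L[ℝ] ℝ)) (hD : Continuous D) (hE : ConditionE f D)
    (F : X → ℝ) (hF : Continuous F) (hFf : ∀ y : Y, F y = f y)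
    (ε : ℝ) (hε : 0 < ε) :
    ∃ G : X → ℝ, ContDiff ℝ 1 G ∧
      (∀ x : X, |F x - G x| < ε) ∧
      (∀ y : Y, ‖D y - (fderiv ℝ G y).comp (diffSpan Y).subtypeL‖ < ε) ∧
      (IsLip (fun y : Y => f y - G y) ∧ lipConst (fun y : Y => f y - G y) < ε) ∧
      (IsLip f → IsLip F → BddAbove (Set.range fun y : Y => ‖D y‖) →
        IsLip G ∧
          lipConst G ≤ ε / 4 + (1 + C₁) * (⨆ y : Y, ‖D y‖) + C₁ * lipConst F) := by
  -- The construction needs a nonnegative constant, whereas `C₀` may be negative when `X` is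
  -- trivial.
  obtain ⟨G, h1, h2, h3, h4, h5⟩ := (hX.mono (le_max_left C₀ 0)).exists_extension_approx
    (le_max_right _ _) hY hD hE hF hFf hε
  obtain ⟨h6, h7⟩ := isLip_and_lipConst_le (g := fun y : Y => f y - G y) (half_pos hε).le h4
  refine ⟨G, h1, h2, h3, ⟨h6, h7.trans_lt (half_lt_self hε)⟩, fun _ hl hb => ?_⟩
  have hM : 0 ≤ ⨆ y : Y, ‖D y‖ := Real.iSup_nonneg fun y => norm_nonneg (D y)
  have hlF := lipConst_nonneg F
  rcases lt_or_ge C₀ 0 with hC | hC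
  · have := hX.subsingleton hC
    obtain ⟨h8, h9⟩ := isLip_and_lipConst_le (g := G) (c := 0) le_rfl fun x y => by
      simp [Subsingleton.elim x y]
    have h10 : lipConst F = 0 := le_antisymm (isLip_and_lipConst_le (g := F) (c := 0) le_rfl
      fun x y => by simp [Subsingleton.elim x y]).2 hlF
    have h11 : ⨆ y : Y, ‖D y‖ = 0 := by
      have : ∀ y, D y = 0 := fun y => by
        ext v
        rw [Subsingleton.elim v 0, map_zero, map_zero]
      simp [this]
    refine ⟨h8, ?_⟩
    rw [h10, h11]
    linarith
  · rw [max_eq_left hC] at h5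
    have hd := h5 _ hM (fun y => le_ciSup hb y) hl
    have h0 := (norm_nonneg _).trans (hd 0)
    obtain ⟨h8, h9⟩ := isLip_and_lipConst_le (g := G) h0 fun x y => by
      rw [dist_eq_norm]
      exact convex_univ.norm_image_sub_le_of_norm_fderiv_le
        (fun z _ => h1.differentiable one_ne_zero z) (fun z _ => hd z)
        (Set.mem_univ y) (Set.mem_univ x)
    refine ⟨h8, h9.trans ?_⟩
    -- The construction yields the factor `3 * C₀`, well within `33 * C₀`.
    rw [hC₁]
    have e1 := mul_nonneg hC hM
    have e2 := mul_nonneg hC hlF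
    linarith
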